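/- Let $d\ge 0$ be an integer, $T>0$ and $x\in\mathbb{R}^d$. Let $V:\mathbb{R}^d\to\mathbb{R}$ be of class $C^2$ with $\nabla^2V(y)$ positive semidefinite for all $y$ outside some compact set, and let $F(y)=G(\|y\|)$, where $G$ is an even real polynomial with $\deg G\ge 2$, $G\ge 0$ on $[0,\infty)$, $G(0)=0$ and $\lim_{r\to+\infty}G(r)=+\infty$. Let $\mathcal{H}_x$ be the set of absolutely continuous functions $f:[0,T]\to\mathbb{R}^d$ with $f(0)=x$. Then there is exactly one $\Psi\in C([0,T];\mathbb{R}^d)$ such that $\Psi(t)=x-\int_0^t\nabla V(\Psi(s))\,ds$ for all $t\in[0,T]$. Define, for $f\in C([0,T];\mathbb{R}^d)$, $$J_\infty(f)=\frac14\int_0^T\left\|\dot f(t)+\nabla V(f(t))+\nabla F\big(f(t)-\Psi(t)\big)\right\|^2dt\in[0,+\infty]\quad\text{if } f\in\mathcal{H}_x,\qquad J_\infty(f)=+\infty\quad\text{otherwise}.$$ For $N\ge1$ and $f_1,\dots,f_N\in C([0,T];\mathbb{R}^d)$, let $$I^N(f_1,\dots,f_N)=\frac14\sum_{i=1}^N\int_0^T\Big\|\dot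 f_i(t)+\nabla V(f_i(t))+\frac1N\sum_{k=1}^N\nabla F\big(f_i(t)-f_k(t)\big)\Big\|^2dt$$ if all $f_i$ belong to $\mathcal{H}_x$, and $I^N(f_1,\dots,f_N)=+\infty$ otherwise, and let $$J_N(f)=\inf_{f_2,\dots,f_N\in\mathcal{H}_x}I^N(f,f_2,\dots,f_N).$$ Then for every subset $O\subset C([0,T];\mathbb{R}^d)$ that is open or closed for the uniform topology, $$\lim_{N\to\infty}\inf_{\varphi\in O}J_N(\varphi)=\inf_{\varphi\in O}J_\infty(\varphi),$$ as a limit in $[0,+\infty]$, with the convention $\inf\emptyset=+\infty$. -/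

import Mathlib

open Set Filter Topology MeasureTheory
open scoped ENNReal

noncomputable section

namespace MeanField

/-- The state space `ℝ^d` with its Euclidean norm. -/
abbrev State (d : ℕ) : Type := EuclideanSpace ℝ (Fin d)

/-- `C([0,T]; ℝ^d)`; its topology in Mathlib is that of uniform convergence, as `[0,T]` is
compact. -/
abbrev Path (d : ℕ) (T : ℝ) : Type := C(Icc (0 : ℝ) T, State d)

/-- Hypotheses on the confining potential: `V` is of class `C^2`, and its Hessian is positive
semidefinite outside some compact set. -/
def IsConfiningPotential {d : ℕ} (V : State d → ℝ) : Prop :=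
  ContDiff ℝ 2 V ∧
    ∃ K : Set (State d), IsCompact K ∧ ∀ y ∉ K, ∀ v : State d, 0 ≤ fderiv ℝ (fderiv ℝ V) y v v

/-- Hypotheses on the interaction potential: `F x = G ‖x‖`, where `G` is an even real polynomial
of degree at least `2`, nonnegative on `[0,∞)`, with `G 0 = 0` and `G r → ∞` as `r → ∞`. -/
def IsInteractionPotential {d : ℕ} (F : State d → ℝ) : Prop :=
  ∃ G : Polynomial ℝ,
    (∀ y, F y = G.eval ‖y‖) ∧
    (∀ r : ℝ, 0 ≤ r → 0 ≤ G.eval r) ∧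
    (∀ r : ℝ, G.eval (-r) = G.eval r) ∧
    2 ≤ G.natDegree ∧
    G.eval 0 = 0 ∧
    Tendsto (fun r : ℝ => G.eval r) atTop atTop

/-- A path seen as a function on `ℝ`, extended by constants outside `[0,T]`. -/
def extendPath {d : ℕ} {T : ℝ} (hT : 0 ≤ T) (f : Path d T) : ℝ → State d :=
  IccExtend hT f

/-- `H_x`: the absolutely continuous paths that start at `x`. -/
def H {d : ℕ} {T : ℝ} (hT : 0 ≤ T) (x : State d) : Set (Path d T) :=
  {f | AbsolutelyContinuousOnInterval (extendPath hT f) 0 T ∧ extendPath hT f 0 = x}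

/-- `Ψ(t) = x - ∫_0^t ∇V(Ψ(s)) ds` for all `t ∈ [0,T]`. -/
def IsLimitFlow {d : ℕ} {T : ℝ} (hT : 0 ≤ T) (V : State d → ℝ) (x : State d)
    (Ψ : Path d T) : Prop :=
  ∀ t ∈ Icc 0 T, extendPath hT Ψ t = x - ∫ s in (0 : ℝ)..t, gradient V (extendPath hT Ψ s)

open scoped Classical in
/-- The rate function `J_∞` of the self-stabilizing diffusion, for the flow `Ψ`. -/
def Jinf {d : ℕ} {T : ℝ} (hT : 0 ≤ T) (V F : State d → ℝ) (x : State d) (Ψ f : Path d T) :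
    ℝ≥0∞ :=
  if f ∈ H hT x then
    4⁻¹ * ∫⁻ t in Icc 0 T, ENNReal.ofReal
      (‖deriv (extendPath hT f) t + gradient V (extendPath hT f t)
          + gradient F (extendPath hT f t - extendPath hT Ψ t)‖ ^ 2)
  else ⊤

open scoped Classical in
/-- The rate function `I^N` of the system of `N` particles. -/
def I {d : ℕ} {T : ℝ} (hT : 0 ≤ T) (V F : State d → ℝ) (x : State d) (N : ℕ)
    (Φ : Fin N → Path d T) : ℝ≥0∞ :=
  if ∀ i, Φ i ∈ H hT x then
    4⁻¹ * ∑ i, ∫⁻ t in Icc 0 T, ENNReal.ofReal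
      (‖deriv (extendPath hT (Φ i)) t + gradient V (extendPath hT (Φ i) t)
          + (1 / (N : ℝ)) • ∑ k, gradient F (extendPath hT (Φ i) t - extendPath hT (Φ k) t)‖ ^ 2)
  else ⊤

/-- The rate function `J_N` of the first particle (which has index `0` in `Fin N`): the infimum of
`I^N(f, f_2, …, f_N)` over `f_2, …, f_N ∈ H_x`. -/
def J {d : ℕ} {T : ℝ} (hT : 0 ≤ T) (V F : State d → ℝ) (x : State d) (N : ℕ) [NeZero N]
    (f : Path d T) : ℝ≥0∞ :=
  ⨅ Φ ∈ {Φ : Fin N → Path d T | Φ 0 = f ∧ ∀ i, i ≠ 0 → Φ i ∈ H hT x}, I hT V F x N Φ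

end MeanField

end

namespace MeanField

variable {d : ℕ} {T : ℝ}

/-! Both rate functions are quarter squared L² norms of a residual, and on sublevel sets they agree
up to O(1/√N). Lower bound: if I^N ≤ B, a Gronwall argument bounds ∑ ‖f_i - Ψ‖² by a constant R
independent of N (`sum_norm_sq_sub_flow_le`). It needs only the one-sided Lipschitz bound for ∇V and
the fact that ∇F is odd with ⟨y, ∇F y⟩ ≥ -c‖y‖². As R bounds the whole sum, replacing the mean of
∇F(f_1 - f_k) by ∇F(f_1 - Ψ) changes the residual by O(1/√N) (`exists_Jinf_le`). Upper bound: let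
all other particles follow Ψ. Each residual then moves by O(1/N), and the N squared perturbations
total O(1/N) (`exists_J_le`). The lower-bound error depends on B alone, not on the path, so the
comparison passes to infima over any set (`tendsto_iInf_J`). -/

/-! ### The confining force -/

theorem contDiff_gradient {V : State d → ℝ} (hV : ContDiff ℝ 2 V) :
    ContDiff ℝ 1 (gradient V) := by
  have h : ContDiff ℝ 1 (fderiv ℝ V) := hV.fderiv_right (by norm_num)
  exact (InnerProductSpace.toDual ℝ (State d)).symm.toContinuousLinearEquiv.contDiff.comp h

theorem inner_gradient {V : State d → ℝ} (y v : State d) :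
    inner ℝ (gradient V y) v = fderiv ℝ V y v := by
  simp [gradient]

/-- The gradient of a confining potential is one-sided Lipschitz. -/
theorem IsConfiningPotential.exists_oneSided {V : State d → ℝ} (hV : IsConfiningPotential V) :
    ∃ K : ℝ, 0 ≤ K ∧ ∀ a b : State d,
      -K * ‖a - b‖ ^ 2 ≤ inner ℝ (gradient V a - gradient V b) (a - b) := by
  obtain ⟨hC, S, hS, hpos⟩ := hV
  have h1 : ContDiff ℝ 1 (fderiv ℝ V) := hC.fderiv_right (by norm_num)
  have h2 : Continuous (fderiv ℝ (fderiv ℝ V)) := h1.continuous_fderiv (by norm_num)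
  have h2' : Continuous fun y => ‖fderiv ℝ (fderiv ℝ V) y‖ :=
    (continuous_norm (E := State d →L[ℝ] State d →L[ℝ] ℝ)).comp h2
  obtain ⟨K, hK⟩ := hS.bddAbove_image h2'.continuousOn
  -- The Hessian is bounded below everywhere: by continuity on the compact set, by positivity off
  -- it. The mean value theorem along the segment from b to a then gives the claim.
  have hlow : ∀ y v : State d, -(max K 0) * ‖v‖ ^ 2 ≤ fderiv ℝ (fderiv ℝ V) y v v := by
    intro y v
    by_cases hy : y ∈ S
    · have h3 := (fderiv ℝ (fderiv ℝ V) y).le_opNorm₂ v v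
      have h4 : ‖fderiv ℝ (fderiv ℝ V) y‖ * ‖v‖ * ‖v‖ ≤ max K 0 * ‖v‖ ^ 2 := by
        rw [mul_assoc, ← sq]
        gcongr
        exact (hK (mem_image_of_mem _ hy)).trans (le_max_left _ _)
      have h5 := neg_abs_le (fderiv ℝ (fderiv ℝ V) y v v)
      rw [Real.norm_eq_abs] at h3
      linarith
    · have h3 := hpos y hy v
      have h4 : 0 ≤ max K 0 * ‖v‖ ^ 2 := by positivity
      linarith
  refine ⟨max K 0, le_max_right _ _, fun a b => ?_⟩
  have hd : ∀ t : ℝ, HasDerivAt (fun t : ℝ => fderiv ℝ V (b + t • (a - b)) (a - b))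
      (fderiv ℝ (fderiv ℝ V) (b + t • (a - b)) (a - b) (a - b)) t := by
    intro t
    have hl : HasDerivAt (fun t : ℝ => b + t • (a - b)) (a - b) t := by
      simpa using ((hasDerivAt_id t).smul_const (a - b)).const_add b
    have h3 := ((h1.differentiable one_ne_zero) (b + t • (a - b))).hasFDerivAt.comp_hasDerivAt t hl
    exact (ContinuousLinearMap.apply ℝ ℝ (a - b)).hasFDerivAt.comp_hasDerivAt t h3
  obtain ⟨t, -, ht⟩ := exists_hasDerivAt_eq_slope _ _ (zero_lt_one' ℝ)
    (fun t _ => (hd t).continuousAt.continuousWithinAt) (fun t _ => hd t)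
  have h3 := hlow (b + t • (a - b)) (a - b)
  rw [ht] at h3
  simpa [inner_sub_left, inner_gradient] using h3

/-! ### The interaction force -/

/-- Odd coefficients equal their own negatives. Writing F as a polynomial in ‖y‖² removes the
singularity of the norm at the origin. -/
theorem exists_comp_sq_of_even {G : Polynomial ℝ} (hG : ∀ r : ℝ, G.eval (-r) = G.eval r) :
    ∃ P : Polynomial ℝ, ∀ r : ℝ, G.eval r = P.eval (r ^ 2) := by
  have hcomp : G.comp (Polynomial.C (-1) * Polynomial.X) = G := Polynomial.funext fun r => by simp [hG]
  refine ⟨G.contract 2, fun r => ?_⟩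
  have : Polynomial.expand ℝ 2 (G.contract 2) = G := by
    ext n
    rw [Polynomial.coeff_expand two_pos, Polynomial.coeff_contract two_ne_zero]
    split_ifs with h
    · rw [Nat.div_mul_cancel h]
    · have h1 := congrArg (fun p => p.coeff n) hcomp
      rw [Polynomial.comp_C_mul_X_coeff, (Nat.not_even_iff_odd.1 (fun h' => h h'.two_dvd)).neg_one_pow] at h1
      linarith
  conv_lhs => rw [← this]
  rw [Polynomial.expand_eval]

/-- The leading coefficient of P is positive, so P' is eventually nonnegative; the remaining
interval is compact. -/
theorem exists_le_eval_derivative {P : Polynomial ℝ}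
    (hP : Tendsto (fun s : ℝ => P.eval s) atTop atTop) :
    ∃ c : ℝ, 0 ≤ c ∧ ∀ s : ℝ, 0 ≤ s → -c ≤ P.derivative.eval s := by
  obtain ⟨hdeg, hlead⟩ := (Polynomial.tendsto_atTop_iff_leadingCoeff_nonneg P).1 hP
  have hn : 0 < P.natDegree := Polynomial.natDegree_pos_iff_degree_pos.2 hdeg
  have key : ∃ s₀ : ℝ, ∀ s, s₀ ≤ s → 0 ≤ P.derivative.eval s := by
    have hl : 0 ≤ P.derivative.leadingCoeff := by
      rw [Polynomial.leadingCoeff_derivative]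
      positivity
    by_cases h : 0 < P.derivative.degree
    · have := (Polynomial.tendsto_atTop_iff_leadingCoeff_nonneg _).2 ⟨h, hl⟩
      exact (eventually_atTop.1 (this.eventually_ge_atTop 0))
    · have h' := Polynomial.eq_C_of_degree_le_zero (not_lt.1 h)
      refine ⟨0, fun s _ => ?_⟩
      rw [h', Polynomial.leadingCoeff_C] at hl
      rw [h', Polynomial.eval_C]
      exact hl
  obtain ⟨s₀, hs₀⟩ := key
  obtain ⟨C, hC⟩ := (isCompact_Icc (a := (0 : ℝ)) (b := s₀)).exists_bound_of_continuousOn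
    (P.derivative.continuous.continuousOn)
  refine ⟨max C 0, le_max_right _ _, fun s hs => ?_⟩
  have h0 : 0 ≤ max C 0 := le_max_right _ _
  rcases le_total s₀ s with h | h
  · linarith [hs₀ s h]
  · have h1 := hC s ⟨hs, h⟩
    rw [Real.norm_eq_abs] at h1
    linarith [neg_abs_le (P.derivative.eval s), le_max_left C 0]

/-- The gradient of an interaction potential is a radial field with a factor that is bounded
below. -/
theorem IsInteractionPotential.exists_radial {F : State d → ℝ} (hF : IsInteractionPotential F) :
    ∃ q : ℝ → ℝ, ContDiff ℝ 1 q ∧ (∀ y, gradient F y = q (‖y‖ ^ 2) • y) ∧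
      ∃ c : ℝ, 0 ≤ c ∧ ∀ s, 0 ≤ s → -c ≤ q s := by
  obtain ⟨G, hFG, -, heven, -, -, hlim⟩ := hF
  obtain ⟨P, hP⟩ := exists_comp_sq_of_even heven
  have hPlim : Tendsto (fun s : ℝ => P.eval s) atTop atTop := by
    refine (hlim.comp Real.tendsto_sqrt_atTop).congr' ?_
    filter_upwards [eventually_ge_atTop 0] with s hs
    simp [hP, Real.sq_sqrt hs]
  obtain ⟨c, hc, hPc⟩ := exists_le_eval_derivative hPlim
  refine ⟨fun s => 2 * P.derivative.eval s, ?_, fun y => ?_,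
    2 * c, by positivity, fun s hs => by linarith [hPc s hs]⟩
  · exact contDiff_const.mul (by simpa only [Polynomial.coe_aeval_eq_eval] using P.derivative.contDiff_aeval (𝕜 := ℝ) 1)
  have hF' : F = fun y => P.eval (‖y‖ ^ 2) := funext fun y => by rw [hFG, hP]
  have h1 : HasFDerivAt F (P.derivative.eval (‖y‖ ^ 2) • (2 • innerSL ℝ y)) y := by
    rw [hF']
    exact (P.hasDerivAt _).comp_hasFDerivAt y (hasStrictFDerivAt_norm_sq y).hasFDerivAt
  refine ext_inner_right ℝ fun v => ?_
  rw [inner_gradient, h1.fderiv]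
  simp [inner_smul_left]
  ring

/-- The properties of the interaction force that enter the large deviation estimates. -/
structure IsInteractionForce (g : State d → State d) (c : ℝ) : Prop where
  contDiff : ContDiff ℝ 1 g
  neg : ∀ y, g (-y) = -g y
  inner_ge : ∀ y, -c * ‖y‖ ^ 2 ≤ inner ℝ y (g y)

theorem IsInteractionForce.zero {g : State d → State d} {c : ℝ} (hg : IsInteractionForce g c) :
    g 0 = 0 := by
  have h := hg.neg 0
  rw [neg_zero] at h
  simpa [← two_smul ℝ] using (eq_neg_iff_add_eq_zero.1 h : g 0 + g 0 = 0)

theorem IsInteractionPotential.isInteractionForce {F : State d → ℝ}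
    (hF : IsInteractionPotential F) : ∃ c, 0 ≤ c ∧ IsInteractionForce (gradient F) c := by
  obtain ⟨q, hq, hgrad, c, hc, hqc⟩ := hF.exists_radial
  refine ⟨c, hc, ?_, fun y => by simp [hgrad], fun y => ?_⟩
  · rw [funext hgrad]
    exact (hq.comp (contDiff_norm_sq ℝ)).smul contDiff_id
  · rw [hgrad, inner_smul_right, real_inner_self_eq_norm_sq]
    exact mul_le_mul_of_nonneg_right (hqc _ (by positivity)) (by positivity)

/-! ### Absolutely continuous paths and Gronwall's inequality -/

theorem _root_.LipschitzWith.comp_absolutelyContinuousOnInterval {X Y : Type*}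
    [PseudoMetricSpace X] [PseudoMetricSpace Y] {φ : X → Y} {K : NNReal} (hφ : LipschitzWith K φ)
    {f : ℝ → X} {a b : ℝ} (hf : AbsolutelyContinuousOnInterval f a b) :
    AbsolutelyContinuousOnInterval (fun t => φ (f t)) a b := by
  unfold AbsolutelyContinuousOnInterval at hf ⊢
  refine squeeze_zero (fun E => Finset.sum_nonneg fun i _ => dist_nonneg) (fun E => ?_)
    (by simpa using hf.const_mul (K : ℝ))
  rw [Finset.mul_sum]
  exact Finset.sum_le_sum fun i _ => hφ.dist_le_mul _ _

theorem _root_.AbsolutelyContinuousOnInterval.congr {X : Type*} [PseudoMetricSpace X]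
    {f g : ℝ → X} {a b : ℝ} (hf : AbsolutelyContinuousOnInterval f a b)
    (hfg : EqOn f g (uIcc a b)) : AbsolutelyContinuousOnInterval g a b := by
  rw [absolutelyContinuousOnInterval_iff] at hf ⊢
  intro ε hε
  obtain ⟨δ, hδ, h⟩ := hf ε hε
  refine ⟨δ, hδ, fun E hE hE' => ?_⟩
  convert h E hE hE' using 1
  refine Finset.sum_congr rfl fun i hi => ?_
  have := hE.1 i (by simpa using hi)
  rw [hfg this.1, hfg this.2]

theorem _root_.AbsolutelyContinuousOnInterval.sum {ι : Type*} {f : ι → ℝ → ℝ} {a b : ℝ}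
    (s : Finset ι) (hf : ∀ i ∈ s, AbsolutelyContinuousOnInterval (f i) a b) :
    AbsolutelyContinuousOnInterval (fun t => ∑ i ∈ s, f i t) a b := by
  classical
  induction s using Finset.induction_on with
  | empty =>
    simpa using (LipschitzWith.const (0 : ℝ)).lipschitzOnWith.absolutelyContinuousOnInterval
      (a := a) (b := b)
  | insert i s hi ih =>
    simp only [Finset.sum_insert hi]
    exact (hf i (by simp)).add (ih fun j hj => hf j (by simp [hj]))

theorem _root_.AbsolutelyContinuousOnInterval.apply {f : ℝ → State d} {a b : ℝ}
    (hf : AbsolutelyContinuousOnInterval f a b) (j : Fin d) :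
    AbsolutelyContinuousOnInterval (fun t => f t j) a b :=
  (EuclideanSpace.proj j : State d →L[ℝ] ℝ).lipschitz.comp_absolutelyContinuousOnInterval hf

theorem _root_.AbsolutelyContinuousOnInterval.norm_sq {f : ℝ → State d} {a b : ℝ}
    (hf : AbsolutelyContinuousOnInterval f a b) :
    AbsolutelyContinuousOnInterval (fun t => ‖f t‖ ^ 2) a b := by
  have h : (fun t => ‖f t‖ ^ 2) = fun t => ∑ j, f t j * f t j := by
    funext t
    rw [EuclideanSpace.real_norm_sq_eq]
    exact Finset.sum_congr rfl fun j _ => sq _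
  rw [h]
  exact .sum _ fun j _ => (hf.apply j).fun_mul (hf.apply j)

theorem _root_.AbsolutelyContinuousOnInterval.ae_differentiableAt_state {f : ℝ → State d}
    {a b : ℝ} (hf : AbsolutelyContinuousOnInterval f a b) :
    ∀ᵐ t : ℝ, t ∈ uIcc a b → DifferentiableAt ℝ f t := by
  have h := ae_all_iff.2 fun j : Fin d => (hf.apply j).ae_differentiableAt
  filter_upwards [h] with t ht hmem
  exact differentiableAt_euclidean.2 fun j => ht j hmem

/-- Gronwall's inequality for absolutely continuous functions. -/
theorem le_exp_mul_integral_of_deriv_le {S h : ℝ → ℝ} {T κ : ℝ}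
    (hS : AbsolutelyContinuousOnInterval S 0 T) (hS0 : S 0 = 0) (hκ : 0 ≤ κ)
    (hh : IntegrableOn h (Icc 0 T)) (hpos : ∀ t, 0 ≤ h t)
    (hle : ∀ᵐ t : ℝ, t ∈ Icc 0 T → deriv S t ≤ κ * S t + h t) {t : ℝ} (ht : t ∈ Icc 0 T) :
    S t ≤ Real.exp (κ * T) * ∫ s in Icc 0 T, h s := by
  have hsub : uIcc 0 t ⊆ uIcc 0 T := by
    rw [uIcc_of_le ht.1, uIcc_of_le (ht.1.trans ht.2)]
    exact Icc_subset_Icc_right ht.2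
  have hS' := hS.mono hsub
  -- Integrating factor: the derivative of e^(-κs) S is a.e. at most e^(-κs) h ≤ h, and absolute
  -- continuity allows integrating this a.e. bound.
  have hE : AbsolutelyContinuousOnInterval (fun s => Real.exp (-κ * s)) 0 t :=
    ContDiffOn.absolutelyContinuousOnInterval (by fun_prop)
  have hP := hE.fun_mul hS'
  have hint : IntegrableOn h (Ioc 0 t) :=
    hh.mono_set (Ioc_subset_Icc_self.trans (Icc_subset_Icc_right ht.2))
  have h1 : Real.exp (-κ * t) * S t ≤ ∫ s in (0 : ℝ)..t, h s := by
    have h2 := hP.integral_deriv_eq_sub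
    simp only [hS0, mul_zero, sub_zero] at h2
    rw [← h2]
    refine intervalIntegral.integral_mono_ae_restrict ht.1 hP.intervalIntegrable_deriv
      ((intervalIntegrable_iff_integrableOn_Ioc_of_le ht.1).2 hint) ?_
    refine (ae_restrict_iff' measurableSet_Icc).2 ?_
    filter_upwards [hle, hS'.ae_differentiableAt] with s hs hd hmem
    have hsd := hd (by rwa [uIcc_of_le ht.1])
    have hsl := hs ⟨hmem.1, hmem.2.trans ht.2⟩
    have he : HasDerivAt (fun s => Real.exp (-κ * s)) (Real.exp (-κ * s) * -κ) s := by
      simpa using ((hasDerivAt_id s).const_mul (-κ)).exp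
    rw [(he.fun_mul hsd.hasDerivAt).deriv]
    have hexp : Real.exp (-κ * s) ≤ 1 := by
      rw [Real.exp_le_one_iff]
      nlinarith [hmem.1]
    have hexp0 := Real.exp_pos (-κ * s)
    nlinarith [hpos s, mul_le_mul_of_nonneg_left hsl hexp0.le,
      mul_le_mul_of_nonneg_right hexp (hpos s)]
  have h3 : ∫ s in (0 : ℝ)..t, h s ≤ ∫ s in Icc 0 T, h s := by
    rw [intervalIntegral.integral_of_le ht.1]
    exact setIntegral_mono_set hh (Eventually.of_forall hpos)
      (Ioc_subset_Icc_self.trans (Icc_subset_Icc_right ht.2)).eventuallyLE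
  have h4 : S t = Real.exp (κ * t) * (Real.exp (-κ * t) * S t) := by
    rw [← mul_assoc, ← Real.exp_add]
    simp
  have h5 : 0 ≤ ∫ s in Icc 0 T, h s := integral_nonneg hpos
  rw [h4]
  calc Real.exp (κ * t) * (Real.exp (-κ * t) * S t)
      ≤ Real.exp (κ * t) * ∫ s in Icc 0 T, h s := by
        gcongr
        exact h1.trans h3
    _ ≤ _ := by
        gcongr
        exact ht.2

/-! ### The limit flow -/

theorem continuous_extendPath (hT : 0 ≤ T) (f : Path d T) : Continuous (extendPath hT f) :=
  f.continuous.Icc_extend'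

namespace IsLimitFlow

variable {hT : 0 ≤ T} {V : State d → ℝ} {x : State d} {Ψ : Path d T}

theorem hasDerivAt_primitive (hV : Continuous (gradient V)) (t : ℝ) :
    HasDerivAt (fun t => x - ∫ s in (0 : ℝ)..t, gradient V (extendPath hT Ψ s))
      (-gradient V (extendPath hT Ψ t)) t := by
  have hc : Continuous fun s => gradient V (extendPath hT Ψ s) :=
    hV.comp (continuous_extendPath hT Ψ)
  exact (intervalIntegral.integral_hasDerivAt_right (hc.intervalIntegrable _ _)
    hc.aestronglyMeasurable.stronglyMeasurableAtFilter hc.continuousAt).const_sub x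

theorem mem_H (h : IsLimitFlow hT V x Ψ) (hV : Continuous (gradient V)) : Ψ ∈ H hT x := by
  refine ⟨?_, by simpa using h 0 ⟨le_rfl, hT⟩⟩
  have hd := fun t => hasDerivAt_primitive (x := x) (hT := hT) (Ψ := Ψ) hV t
  have hc : ContDiff ℝ 1
      (fun t => x - ∫ s in (0 : ℝ)..t, gradient V (extendPath hT Ψ s)) := by
    refine contDiff_one_iff_deriv.2 ⟨fun t => (hd t).differentiableAt, ?_⟩
    rw [deriv_eq hd]
    exact (hV.comp (continuous_extendPath hT Ψ)).neg
  refine hc.contDiffOn.absolutelyContinuousOnInterval.congr fun t ht => ?_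
  rw [uIcc_of_le hT] at ht
  exact (h t ht).symm

/-- The endpoints are excluded because the constant extension may have a corner there; they form a
null set. -/
theorem hasDerivAt (h : IsLimitFlow hT V x Ψ) (hV : Continuous (gradient V)) {t : ℝ}
    (ht : t ∈ Ioo 0 T) :
    HasDerivAt (extendPath hT Ψ) (-gradient V (extendPath hT Ψ t)) t := by
  refine (hasDerivAt_primitive (x := x) hV t).congr_of_eventuallyEq ?_
  filter_upwards [Icc_mem_nhds ht.1 ht.2] with s hs using h s hs

end IsLimitFlow

/-- A vector field of class `C¹` with compact support has global integral curves. -/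
theorem exists_integralCurve {f : State d → State d} (hf : ContDiff ℝ 1 f)
    (hsupp : HasCompactSupport f) (hT : 0 ≤ T) (x : State d) :
    ∃ α : ℝ → State d, α 0 = x ∧ AbsolutelyContinuousOnInterval α 0 T ∧
      ∀ t ∈ Icc 0 T, HasDerivWithinAt α (f (α t)) (Icc 0 T) t := by
  obtain ⟨K, hK⟩ := hf.lipschitzWith_of_hasCompactSupport hsupp one_ne_zero
  obtain ⟨L, hL⟩ := hsupp.exists_bound_of_continuous hf.continuous
  have hL0 : 0 ≤ L := (norm_nonneg _).trans (hL x)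
  lift L to NNReal using hL0
  have hP : IsPicardLindelof (fun _ => f) (⟨0, le_rfl, hT⟩ : Icc 0 T) x (L * T.toNNReal) 0 L K :=
    .of_time_independent (fun y _ => hL y) hK.lipschitzOnWith (by simp [hT])
  obtain ⟨α, h0, hα⟩ := hP.exists_eq_forall_mem_Icc_hasDerivWithinAt (x := x) (by simp)
  refine ⟨α, h0, ?_, hα⟩
  have hlip : LipschitzOnWith L α (uIcc 0 T) := by
    rw [uIcc_of_le hT]
    exact (convex_Icc 0 T).lipschitzOnWith_of_nnnorm_hasDerivWithin_le hα fun t _ => hL _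
  exact hlip.absolutelyContinuousOnInterval

/-- ∇V is only locally Lipschitz, so it is cut off by a bump χ. The energy bound D holds for every
cutoff with values in [0, 1], so choosing χ = 1 on a ball of radius above √D ensures that the
solution never feels it. -/
theorem exists_isLimitFlow (hT : 0 ≤ T) {V : State d → ℝ} (hV : ContDiff ℝ 1 (gradient V))
    {K : ℝ} (hK : 0 ≤ K)
    (hone : ∀ a b : State d,
      -K * ‖a - b‖ ^ 2 ≤ inner ℝ (gradient V a - gradient V b) (a - b))
    (x : State d) : ∃ Ψ : Path d T, IsLimitFlow hT V x Ψ := by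
  set D : ℝ := Real.exp ((2 * K + 1) * T) * ∫ _s in Icc 0 T, ‖gradient V x‖ ^ 2 with hD
  have hD0 : 0 ≤ D := mul_nonneg (Real.exp_pos _).le (integral_nonneg fun _ => by positivity)
  let χ : ContDiffBump x := ⟨Real.sqrt D + 1, Real.sqrt D + 2, by positivity, by linarith⟩
  obtain ⟨α, h0, hac, hα⟩ := exists_integralCurve (f := fun y => -(χ y • gradient V y))
    (χ.contDiff.smul hV).neg (χ.hasCompactSupport.smul_right).neg hT x
  have hbound : ∀ t ∈ Icc 0 T, ‖α t - x‖ ^ 2 ≤ D := by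
    intro t ht
    have hac' : AbsolutelyContinuousOnInterval (fun t => α t - x) 0 T :=
      (LipschitzWith.id.sub (LipschitzWith.const x)).comp_absolutelyContinuousOnInterval hac
    refine le_exp_mul_integral_of_deriv_le hac'.norm_sq (by simp [h0]) (by positivity)
      (by simp) (fun _ => by positivity) ?_ ht
    filter_upwards [compl_mem_ae_iff.2 (measure_singleton (0 : ℝ)),
      compl_mem_ae_iff.2 (measure_singleton T)] with s hs0 hsT hs
    have hs' : s ∈ Ioo 0 T := ⟨lt_of_le_of_ne hs.1 (Ne.symm hs0), lt_of_le_of_ne hs.2 hsT⟩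
    have hd := (((hα s hs).hasDerivAt (Icc_mem_nhds hs'.1 hs'.2)).sub_const x).norm_sq
    rw [hd.deriv]
    have h1 := hone (α s) x
    have h2 : inner ℝ (α s - x) (-(χ (α s) • gradient V (α s))) =
        -χ (α s) * (inner ℝ (gradient V (α s) - gradient V x) (α s - x)
          + inner ℝ (α s - x) (gradient V x)) := by
      rw [inner_neg_right, inner_smul_right, real_inner_comm (α s - x) (gradient V (α s) - _),
        inner_sub_right (α s - x) (gradient V (α s))]
      ring
    rw [h2]
    have h3 := neg_le_of_abs_le (abs_real_inner_le_norm (α s - x) (gradient V x))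
    have hχ0 : 0 ≤ χ (α s) := χ.nonneg
    have hχ1 : χ (α s) ≤ 1 := χ.le_one
    have h5 : -(K * ‖α s - x‖ ^ 2 + ‖α s - x‖ * ‖gradient V x‖) ≤
        inner ℝ (gradient V (α s) - gradient V x) (α s - x)
          + inner ℝ (α s - x) (gradient V x) := by linarith
    have h6 : 0 ≤ K * ‖α s - x‖ ^ 2 + ‖α s - x‖ * ‖gradient V x‖ := by positivity
    nlinarith [mul_le_mul_of_nonneg_left h5 hχ0, mul_le_mul_of_nonneg_right hχ1 h6,
      sq_nonneg (‖α s - x‖ - ‖gradient V x‖)]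
  have hα' : ∀ t ∈ Icc 0 T, HasDerivWithinAt α (-gradient V (α t)) (Icc 0 T) t := by
    intro t ht
    have h1 : χ (α t) = 1 := by
      refine χ.one_of_mem_closedBall ?_
      rw [mem_closedBall_iff_norm]
      exact (Real.le_sqrt_of_sq_le (hbound t ht)).trans (by simp [χ])
    simpa [h1] using hα t ht
  have hcont : ContinuousOn α (Icc 0 T) := fun t ht => (hα' t ht).continuousWithinAt
  let Ψ : Path d T := ⟨fun t => α t, hcont.domRestrict⟩
  have hΨ : ∀ t ∈ Icc 0 T, extendPath hT Ψ t = α t := fun t ht => IccExtend_of_mem hT _ ht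
  refine ⟨Ψ, fun t ht => ?_⟩
  have hsub : Icc 0 t ⊆ Icc 0 T := Icc_subset_Icc_right ht.2
  have hc : ContinuousOn (fun s => -gradient V (α s)) (uIcc 0 t) := by
    rw [uIcc_of_le ht.1]
    exact (hV.continuous.comp_continuousOn (hcont.mono hsub)).neg
  have h1 := intervalIntegral.integral_eq_sub_of_hasDerivAt_of_le ht.1 (hcont.mono hsub)
    (fun s hs => (hα' s (hsub (Ioo_subset_Icc_self hs))).hasDerivAt
      (Icc_mem_nhds hs.1 (hs.2.trans_le ht.2))) hc.intervalIntegrable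
  have h2 : ∫ s in (0 : ℝ)..t, gradient V (extendPath hT Ψ s) =
      ∫ s in (0 : ℝ)..t, gradient V (α s) := by
    refine intervalIntegral.integral_congr fun s hs => ?_
    rw [uIcc_of_le ht.1] at hs
    simp only [hΨ s (hsub hs)]
  rw [intervalIntegral.integral_neg, h0] at h1
  rw [hΨ t ht, h2, sub_eq_add_neg, h1]
  abel

/-! ### Distance of the particles to the flow -/

/-- Exchanging i and k and using that g is odd turns the double sum into half of ∑ ⟨z_i - z_k, g(z_i
- z_k)⟩ ≥ -c ∑ ‖z_i - z_k‖². The factor N from the double sum cancels the mean-field 1/N. -/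
theorem neg_sum_inner_interaction_le {g : State d → State d} {c : ℝ}
    (hg : IsInteractionForce g c) (hc : 0 ≤ c) {N : ℕ} [NeZero N] (z : Fin N → State d) :
    -(∑ i, inner ℝ (z i) ((1 / (N : ℝ)) • ∑ k, g (z i - z k))) ≤ 2 * c * ∑ i, ‖z i‖ ^ 2 := by
  have hN : (0 : ℝ) < N := by exact_mod_cast Nat.pos_of_neZero N
  set A : ℝ := ∑ i, ∑ k, inner ℝ (z i) (g (z i - z k)) with hA
  have hsym : A = -∑ i, ∑ k, inner ℝ (z k) (g (z i - z k)) := by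
    rw [hA, Finset.sum_comm, ← Finset.sum_neg_distrib]
    refine Finset.sum_congr rfl fun i _ => ?_
    rw [← Finset.sum_neg_distrib]
    refine Finset.sum_congr rfl fun k _ => ?_
    rw [← neg_sub (z i) (z k), hg.neg, inner_neg_right]
  have h2 : 2 * A = ∑ i, ∑ k, inner ℝ (z i - z k) (g (z i - z k)) := by
    simp only [inner_sub_left, Finset.sum_sub_distrib]
    linarith
  have h3 : ∑ i, ∑ k, -c * (2 * ‖z i‖ ^ 2 + 2 * ‖z k‖ ^ 2) ≤ 2 * A := by
    rw [h2]
    refine Finset.sum_le_sum fun i _ => Finset.sum_le_sum fun k _ => ?_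
    have h4 := hg.inner_ge (z i - z k)
    have h5 : ‖z i - z k‖ ^ 2 ≤ 2 * ‖z i‖ ^ 2 + 2 * ‖z k‖ ^ 2 := by
      nlinarith [parallelogram_law_with_norm ℝ (z i) (z k), sq_nonneg ‖z i + z k‖]
    nlinarith [mul_le_mul_of_nonneg_left h5 hc]
  have h6 : ∑ i, ∑ k, -c * (2 * ‖z i‖ ^ 2 + 2 * ‖z k‖ ^ 2) = -(4 * c * N * ∑ i, ‖z i‖ ^ 2) := by
    simp only [← Finset.mul_sum, Finset.sum_add_distrib, Finset.sum_const, Finset.card_univ,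
      Fintype.card_fin, nsmul_eq_mul]
    ring
  have h7 : ∑ i, inner ℝ (z i) ((1 / (N : ℝ)) • ∑ k, g (z i - z k)) = 1 / (N : ℝ) * A := by
    simp only [inner_smul_right, inner_sum, ← Finset.mul_sum, hA]
  rw [h7]
  rw [h6] at h3
  have h8 : 1 / (N : ℝ) * (-(2 * c * N * ∑ i, ‖z i‖ ^ 2)) ≤ 1 / (N : ℝ) * A := by
    gcongr
    linarith
  have h9 : 1 / (N : ℝ) * (-(2 * c * N * ∑ i, ‖z i‖ ^ 2)) = -(2 * c * ∑ i, ‖z i‖ ^ 2) := by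
    field_simp
  linarith

/-- Here p is the velocity of the particles and -b ψ that of the flow, so the left side is the
derivative of ∑ ‖y_i - ψ‖². The last sum is the integrand of 4 I^N. -/
theorem sum_inner_drift_le {b g : State d → State d} {K c : ℝ} (hc : 0 ≤ c)
    (hone : ∀ y z : State d, -K * ‖y - z‖ ^ 2 ≤ inner ℝ (b y - b z) (y - z))
    (hg : IsInteractionForce g c) {N : ℕ} [NeZero N] (y p : Fin N → State d) (ψ : State d) :
    ∑ i, 2 * inner ℝ (y i - ψ) (p i + b ψ) ≤ (2 * K + 4 * c + 1) * ∑ i, ‖y i - ψ‖ ^ 2 +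
      ∑ i, ‖p i + b (y i) + (1 / (N : ℝ)) • ∑ k, g (y i - y k)‖ ^ 2 := by
  have h1 := neg_sum_inner_interaction_le hg hc fun i => y i - ψ
  simp only [sub_sub_sub_cancel_right] at h1
  have h2 : ∀ i, 2 * inner ℝ (y i - ψ) (p i + b ψ) ≤ (2 * K + 1) * ‖y i - ψ‖ ^ 2 +
      ‖p i + b (y i) + (1 / (N : ℝ)) • ∑ k, g (y i - y k)‖ ^ 2 -
      2 * inner ℝ (y i - ψ) ((1 / (N : ℝ)) • ∑ k, g (y i - y k)) := by
    intro i
    set u := (1 / (N : ℝ)) • ∑ k, g (y i - y k)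
    have h3 : p i + b ψ = (p i + b (y i) + u) - (b (y i) - b ψ) - u := by abel
    have h4 := hone (y i) ψ
    have h5 := real_inner_le_norm (y i - ψ) (p i + b (y i) + u)
    rw [h3, inner_sub_right, inner_sub_right, real_inner_comm (b (y i) - b ψ) (y i - ψ)]
    rw [real_inner_comm] at h4
    nlinarith [sq_nonneg (‖y i - ψ‖ - ‖p i + b (y i) + u‖),
      real_inner_comm (b (y i) - b ψ) (y i - ψ)]
  calc _ ≤ _ := Finset.sum_le_sum fun i _ => h2 i
    _ ≤ _ := by
      rw [Finset.sum_sub_distrib, Finset.sum_add_distrib, ← Finset.mul_sum, ← Finset.mul_sum]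
      linarith

theorem measurable_drift {hT : 0 ≤ T} {V : State d → ℝ} {g : State d → State d}
    (hV : Continuous (gradient V)) (hg : Continuous g) {N : ℕ} (Φ : Fin N → Path d T)
    (i : Fin N) :
    Measurable fun t => deriv (extendPath hT (Φ i)) t + gradient V (extendPath hT (Φ i) t)
      + (1 / (N : ℝ)) • ∑ k, g (extendPath hT (Φ i) t - extendPath hT (Φ k) t) := by
  have hc := fun k => continuous_extendPath hT (Φ k)
  refine ((measurable_deriv _).add (hV.comp (hc i)).measurable).add (Continuous.measurable ?_)
  fun_prop

/-- A bound on the rate function of the particle system controls the distance of the particles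
to the limit flow, uniformly in their number. -/
theorem sum_norm_sq_sub_flow_le (hT : 0 ≤ T) {V F : State d → ℝ} {x : State d} {K c : ℝ}
    (hK : 0 ≤ K) (hc : 0 ≤ c) (hV : Continuous (gradient V))
    (hone : ∀ y z : State d, -K * ‖y - z‖ ^ 2 ≤ inner ℝ (gradient V y - gradient V z) (y - z))
    (hg : IsInteractionForce (gradient F) c) {Ψ : Path d T} (hΨ : IsLimitFlow hT V x Ψ)
    {N : ℕ} [NeZero N] {Φ : Fin N → Path d T} {B : ℝ} (hB : 0 ≤ B)
    (hI : I hT V F x N Φ ≤ ENNReal.ofReal B) {t : ℝ} (ht : t ∈ Icc 0 T) :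
    ∑ i, ‖extendPath hT (Φ i) t - extendPath hT Ψ t‖ ^ 2 ≤
      Real.exp ((2 * K + 4 * c + 1) * T) * (4 * B) := by
  have hH : ∀ i, Φ i ∈ H hT x := by
    by_contra h
    rw [I, if_neg h] at hI
    exact absurd hI (by simp)
  rw [I, if_pos hH] at hI
  have hmeas := measurable_drift (hT := hT) hV hg.contDiff.continuous Φ
  set w : Fin N → ℝ → State d := fun i t =>
    deriv (extendPath hT (Φ i)) t + gradient V (extendPath hT (Φ i) t)
      + (1 / (N : ℝ)) • ∑ k, gradient F (extendPath hT (Φ i) t - extendPath hT (Φ k) t) with hw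
  have hlin : ∫⁻ t in Icc 0 T, ENNReal.ofReal (∑ i, ‖w i t‖ ^ 2) ≤ ENNReal.ofReal (4 * B) := by
    have h1 : ∀ t, ENNReal.ofReal (∑ i, ‖w i t‖ ^ 2) = ∑ i, ENNReal.ofReal (‖w i t‖ ^ 2) :=
      fun t => ENNReal.ofReal_sum_of_nonneg fun i _ => by positivity
    simp only [h1]
    rw [lintegral_finsetSum _ fun i _ => ((hmeas i).norm.pow_const 2).ennreal_ofReal,
      ENNReal.ofReal_mul (by norm_num), ENNReal.ofReal_ofNat]
    calc _ = 4 * (4⁻¹ * ∑ i, ∫⁻ t in Icc 0 T, ENNReal.ofReal (‖w i t‖ ^ 2)) := by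
          rw [← mul_assoc, ENNReal.mul_inv_cancel (by norm_num) (by norm_num), one_mul]
      _ ≤ _ := by gcongr
  have hm : Measurable fun t => ∑ i, ‖w i t‖ ^ 2 :=
    Finset.measurable_sum _ fun i _ => (hmeas i).norm.pow_const 2
  have hpos : ∀ t, 0 ≤ ∑ i, ‖w i t‖ ^ 2 := fun t => Finset.sum_nonneg fun i _ => by positivity
  have hint : IntegrableOn (fun t => ∑ i, ‖w i t‖ ^ 2) (Icc 0 T) :=
    (lintegral_ofReal_ne_top_iff_integrable hm.aestronglyMeasurable
      (Eventually.of_forall hpos)).1 (hlin.trans_lt ENNReal.ofReal_lt_top).ne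
  have hle : ∫ t in Icc 0 T, ∑ i, ‖w i t‖ ^ 2 ≤ 4 * B := by
    rw [integral_eq_lintegral_of_nonneg_ae (Eventually.of_forall hpos) hm.aestronglyMeasurable]
    exact ENNReal.toReal_le_of_le_ofReal (by positivity) hlin
  have hΨH := hΨ.mem_H hV
  refine (le_exp_mul_integral_of_deriv_le (S := fun t =>
    ∑ i, ‖extendPath hT (Φ i) t - extendPath hT Ψ t‖ ^ 2) (κ := 2 * K + 4 * c + 1)
    (.sum _ fun i _ => ((hH i).1.sub hΨH.1).norm_sq) ?_ (by positivity) hint hpos ?_ ht).trans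
    (by gcongr)
  · simp [(hH _).2, hΨH.2]
  · have hdiff := ae_all_iff.2 fun i => (hH i).1.ae_differentiableAt_state
    filter_upwards [hdiff, compl_mem_ae_iff.2 (measure_singleton (0 : ℝ)),
      compl_mem_ae_iff.2 (measure_singleton T)] with s hs hs0 hsT hmem
    have hs' : s ∈ Ioo 0 T := ⟨lt_of_le_of_ne hmem.1 (Ne.symm hs0), lt_of_le_of_ne hmem.2 hsT⟩
    have hd := HasDerivAt.fun_sum (u := Finset.univ) fun (i : Fin N) _ =>
      ((hs i (by rwa [uIcc_of_le hT])).hasDerivAt.fun_sub (hΨ.hasDerivAt hV hs')).norm_sq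
    rw [hd.deriv]
    simp only [sub_neg_eq_add]
    exact sum_inner_drift_le hc hone hg (fun i => extendPath hT (Φ i) s)
      (fun i => deriv (extendPath hT (Φ i)) s) (extendPath hT Ψ s)

/-! ### Perturbation of the action, and uniqueness of the flow -/

/-- Young's inequality with a weight: the main term keeps a factor close to 1, as a sharp limit
requires. -/
theorem norm_add_sq_le_weighted {E : Type*} [NormedAddCommGroup E] (h u : E) {η : ℝ}
    (hη : 0 < η) : ‖h + u‖ ^ 2 ≤ (1 + η) * ‖h‖ ^ 2 + (1 + η⁻¹) * ‖u‖ ^ 2 := by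
  have h1 : ‖h + u‖ ^ 2 ≤ (‖h‖ + ‖u‖) ^ 2 := by
    gcongr
    exact norm_add_le h u
  have h2 : (1 + η) * ‖h‖ ^ 2 + (1 + η⁻¹) * ‖u‖ ^ 2 - (‖h‖ + ‖u‖) ^ 2 =
      η⁻¹ * (η * ‖h‖ - ‖u‖) ^ 2 := by
    field_simp
    ring
  have h3 : 0 ≤ η⁻¹ * (η * ‖h‖ - ‖u‖) ^ 2 := by positivity
  linarith

theorem lintegral_norm_add_sq_le {h u : ℝ → State d} {D η : ℝ} (hη : 0 < η)
    (hD : 0 ≤ D) (hu : ∀ t ∈ Icc 0 T, ‖u t‖ ^ 2 ≤ D) :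
    ∫⁻ t in Icc 0 T, ENNReal.ofReal (‖h t + u t‖ ^ 2) ≤
      ENNReal.ofReal (1 + η) * (∫⁻ t in Icc 0 T, ENNReal.ofReal (‖h t‖ ^ 2)) +
        ENNReal.ofReal ((1 + η⁻¹) * (T * D)) := by
  have hη1 : 0 ≤ 1 + η⁻¹ := by positivity
  calc _ ≤ ∫⁻ t in Icc 0 T, (ENNReal.ofReal (1 + η) * ENNReal.ofReal (‖h t‖ ^ 2) +
        ENNReal.ofReal ((1 + η⁻¹) * D)) := by
        refine setLIntegral_mono' measurableSet_Icc fun t ht => ?_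
        rw [← ENNReal.ofReal_mul (by positivity), ← ENNReal.ofReal_add (by positivity)
          (by positivity)]
        refine ENNReal.ofReal_le_ofReal ((norm_add_sq_le_weighted _ _ hη).trans ?_)
        gcongr
        exact hu t ht
    _ = _ := by
        rw [lintegral_add_right _ measurable_const, lintegral_const_mul' _ _ ENNReal.ofReal_ne_top,
          setLIntegral_const, Real.volume_Icc, sub_zero, ← ENNReal.ofReal_mul (by positivity)]
        ring_nf

theorem lintegral_norm_add_sq_le_ofReal (hT : 0 ≤ T) {h u : ℝ → State d} {B D η : ℝ}
    (hη : 0 < η) (hD : 0 ≤ D) (hB : 0 ≤ B) (hu : ∀ t ∈ Icc 0 T, ‖u t‖ ^ 2 ≤ D)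
    (hh : 4⁻¹ * ∫⁻ t in Icc 0 T, ENNReal.ofReal (‖h t‖ ^ 2) ≤ ENNReal.ofReal B) :
    4⁻¹ * ∫⁻ t in Icc 0 T, ENNReal.ofReal (‖h t + u t‖ ^ 2) ≤
      ENNReal.ofReal ((1 + η) * B + (1 + η⁻¹) * (T * D / 4)) := by
  have h4 : (4⁻¹ : ℝ≥0∞) = ENNReal.ofReal 4⁻¹ := by
    rw [ENNReal.ofReal_inv_of_pos (by norm_num), ENNReal.ofReal_ofNat]
  have hη1 : 0 ≤ 1 + η⁻¹ := by positivity
  calc _ ≤ 4⁻¹ * (ENNReal.ofReal (1 + η) * (∫⁻ t in Icc 0 T, ENNReal.ofReal (‖h t‖ ^ 2)) +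
        ENNReal.ofReal ((1 + η⁻¹) * (T * D))) := by
        gcongr
        exact lintegral_norm_add_sq_le hη hD hu
    _ = ENNReal.ofReal (1 + η) * (4⁻¹ * ∫⁻ t in Icc 0 T, ENNReal.ofReal (‖h t‖ ^ 2)) +
        ENNReal.ofReal ((1 + η⁻¹) * (T * D / 4)) := by
        rw [mul_add, mul_left_comm]
        congr 1
        rw [h4, ← ENNReal.ofReal_mul (by positivity)]
        congr 1
        ring
    _ ≤ ENNReal.ofReal (1 + η) * ENNReal.ofReal B +
        ENNReal.ofReal ((1 + η⁻¹) * (T * D / 4)) := by gcongr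
    _ = _ := by
        rw [← ENNReal.ofReal_mul (by positivity), ENNReal.ofReal_add (by positivity)
          (by positivity)]

/-- A one-particle system has no self-interaction, so Ψ₁ has zero action and the distance bound with
B = 0 forces Ψ₁ = Ψ₂. -/
theorem IsLimitFlow.unique (hT : 0 ≤ T) {V F : State d → ℝ} {x : State d} {K c : ℝ}
    (hK : 0 ≤ K) (hc : 0 ≤ c) (hV : Continuous (gradient V))
    (hone : ∀ y z : State d, -K * ‖y - z‖ ^ 2 ≤ inner ℝ (gradient V y - gradient V z) (y - z))
    (hg : IsInteractionForce (gradient F) c) {Ψ₁ Ψ₂ : Path d T} (h₁ : IsLimitFlow hT V x Ψ₁)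
    (h₂ : IsLimitFlow hT V x Ψ₂) : Ψ₁ = Ψ₂ := by
  have hI : I hT V F x 1 (fun _ => Ψ₁) ≤ ENNReal.ofReal 0 := by
    rw [I, if_pos fun _ => h₁.mem_H hV, ← restrict_Ioo_eq_restrict_Icc]
    simp only [Finset.univ_unique, Finset.sum_singleton, sub_self, hg.zero, smul_zero, add_zero]
    rw [setLIntegral_congr_fun (g := fun _ => 0) measurableSet_Ioo fun t ht => by
      simp [(h₁.hasDerivAt hV ht).deriv]]
    simp
  ext1 t
  have h := sum_norm_sq_sub_flow_le hT hK hc hV hone hg h₂ le_rfl hI t.2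
  simp only [Finset.univ_unique, Finset.sum_singleton, mul_zero] at h
  have h0 : ‖extendPath hT Ψ₁ t - extendPath hT Ψ₂ t‖ = 0 :=
    pow_eq_zero_iff two_ne_zero |>.1 (le_antisymm h (by positivity))
  simpa [extendPath, sub_eq_zero] using h0

/-! ### Comparison of the rate functions -/

/-- The rate function of the limit at the first path of a system of `N` paths is controlled by the
rate function of the system, up to an error of order `1 / N`. -/
theorem exists_Jinf_le (hT : 0 ≤ T) {V F : State d → ℝ} {x : State d} {K c : ℝ}
    (hK : 0 ≤ K) (hc : 0 ≤ c) (hV : Continuous (gradient V))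
    (hone : ∀ y z : State d, -K * ‖y - z‖ ^ 2 ≤ inner ℝ (gradient V y - gradient V z) (y - z))
    (hg : IsInteractionForce (gradient F) c) {Ψ : Path d T} (hΨ : IsLimitFlow hT V x Ψ)
    {B : ℝ} (hB : 0 ≤ B) :
    ∃ C : ℝ, ∀ (N : ℕ) [NeZero N] (Φ : Fin N → Path d T) (η : ℝ), 0 < η →
      I hT V F x N Φ ≤ ENNReal.ofReal B →
      Jinf hT V F x Ψ (Φ 0) ≤ ENNReal.ofReal ((1 + η) * B + (1 + η⁻¹) * (C / N)) := by
  set R : ℝ := Real.exp ((2 * K + 4 * c + 1) * T) * (4 * B) with hR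
  have hR0 : 0 ≤ R := by positivity
  -- Every particle is within √R of the flow, hence within 2√R of any other particle.
  obtain ⟨L, hL⟩ := hg.contDiff.contDiffOn.exists_lipschitzOnWith one_ne_zero
    (convex_closedBall (0 : State d) (2 * Real.sqrt R)) (isCompact_closedBall _ _)
  refine ⟨T * (L ^ 2 * R) / 4, fun N _ Φ η hη hI => ?_⟩
  have hN : (0 : ℝ) < N := by exact_mod_cast Nat.pos_of_neZero N
  have hsum := fun t ht => sum_norm_sq_sub_flow_le hT hK hc hV hone hg hΨ hB hI (t := t) ht
  have hH : ∀ i, Φ i ∈ H hT x := by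
    by_contra h
    rw [I, if_neg h] at hI
    exact absurd hI (by simp)
  rw [I, if_pos hH] at hI
  rw [Jinf, if_pos (hH 0)]
  set f := fun i => extendPath hT (Φ i) with hf
  set ψ := extendPath hT Ψ with hψ
  set h : ℝ → State d := fun t => deriv (f 0) t + gradient V (f 0 t) +
    (1 / (N : ℝ)) • ∑ k, gradient F (f 0 t - f k t) with hh
  set u : ℝ → State d := fun t => (1 / (N : ℝ)) •
    ∑ k, (gradient F (f 0 t - ψ t) - gradient F (f 0 t - f k t)) with hu
  have hfu : ∀ t, deriv (f 0) t + gradient V (f 0 t) + gradient F (f 0 t - ψ t) = h t + u t := by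
    intro t
    simp only [hh, hu, Finset.sum_sub_distrib, smul_sub, Finset.sum_const, Finset.card_univ,
      Fintype.card_fin, ← Nat.cast_smul_eq_nsmul ℝ, smul_smul, one_div_mul_cancel hN.ne', one_smul]
    abel
  have hbound : ∀ t ∈ Icc 0 T, ‖u t‖ ^ 2 ≤ L ^ 2 * R / N := by
    intro t ht
    have hR' : ∑ i, ‖f i t - ψ t‖ ^ 2 ≤ R := hsum t ht
    have hnorm : ∀ i, ‖f i t - ψ t‖ ≤ Real.sqrt R := fun i => Real.le_sqrt_of_sq_le
      ((Finset.single_le_sum (f := fun i => ‖f i t - ψ t‖ ^ 2) (fun i _ => by positivity)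
        (Finset.mem_univ i)).trans hR')
    have h1 : ∀ k, ‖gradient F (f 0 t - ψ t) - gradient F (f 0 t - f k t)‖ ≤
        L * ‖f k t - ψ t‖ := by
      intro k
      have hm1 : f 0 t - ψ t ∈ Metric.closedBall (0 : State d) (2 * Real.sqrt R) := by
        rw [mem_closedBall_zero_iff]
        linarith [hnorm 0, Real.sqrt_nonneg R]
      have hm2 : f 0 t - f k t ∈ Metric.closedBall (0 : State d) (2 * Real.sqrt R) := by
        rw [mem_closedBall_zero_iff]
        have := norm_sub_le (f 0 t - ψ t) (f k t - ψ t)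
        rw [sub_sub_sub_cancel_right] at this
        linarith [hnorm 0, hnorm k]
      simpa using hL.norm_sub_le hm1 hm2
    have h2 : ‖u t‖ ≤ 1 / (N : ℝ) * ∑ k, L * ‖f k t - ψ t‖ := by
      rw [hu, norm_smul, Real.norm_of_nonneg (by positivity)]
      gcongr
      exact norm_sum_le_of_le _ fun k _ => h1 k
    -- Cauchy–Schwarz yields N rather than N², because R bounds the full sum of squares.
    have h3 : (∑ k, L * ‖f k t - ψ t‖) ^ 2 ≤ N * (L ^ 2 * R) := by
      refine sq_sum_le_card_mul_sum_sq.trans ?_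
      rw [Finset.card_univ, Fintype.card_fin]
      simp only [mul_pow, ← Finset.mul_sum]
      gcongr
    calc ‖u t‖ ^ 2 ≤ (1 / (N : ℝ) * ∑ k, L * ‖f k t - ψ t‖) ^ 2 := by gcongr
      _ ≤ (1 / (N : ℝ)) ^ 2 * (N * (L ^ 2 * R)) := by
        rw [mul_pow]
        gcongr
      _ = _ := by field_simp
  have hfirst : 4⁻¹ * ∫⁻ t in Icc 0 T, ENNReal.ofReal (‖h t‖ ^ 2) ≤ ENNReal.ofReal B := by
    refine le_trans ?_ hI
    gcongr
    exact Finset.single_le_sum (f := fun i => ∫⁻ t in Icc 0 T, ENNReal.ofReal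
      (‖deriv (f i) t + gradient V (f i t) +
        (1 / (N : ℝ)) • ∑ k, gradient F (f i t - f k t)‖ ^ 2)) (fun _ _ => zero_le)
      (Finset.mem_univ 0)
  have := lintegral_norm_add_sq_le_ofReal hT hη (by positivity) hB hbound hfirst
  simp only [← hfu] at this
  have hrw : T * (L ^ 2 * R / N) / 4 = T * (L ^ 2 * R) / 4 / N := by ring
  rwa [hrw] at this

/-- The rate function of the first particle is controlled by the rate function of the limit, up to
an error of order `1 / N`. -/
theorem exists_J_le (hT : 0 ≤ T) {V F : State d → ℝ} {x : State d} {c : ℝ}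
    (hV : Continuous (gradient V)) (hg : IsInteractionForce (gradient F) c)
    {Ψ : Path d T} (hΨ : IsLimitFlow hT V x Ψ) {φ : Path d T} {B : ℝ} (hB : 0 ≤ B)
    (hφ : Jinf hT V F x Ψ φ ≤ ENNReal.ofReal B) :
    ∃ C : ℝ, ∀ (N : ℕ) [NeZero N] (η : ℝ), 0 < η →
      J hT V F x N φ ≤ ENNReal.ofReal ((1 + η) * B + (1 + η⁻¹) * (C / N)) := by
  have hφH : φ ∈ H hT x := by
    by_contra h
    rw [Jinf, if_neg h] at hφ
    exact absurd hφ (by simp)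
  rw [Jinf, if_pos hφH] at hφ
  have hΨH := hΨ.mem_H hV
  set f := extendPath hT φ with hf
  set ψ := extendPath hT Ψ with hψ
  have hcont : Continuous fun t => gradient F (f t - ψ t) :=
    hg.contDiff.continuous.comp ((continuous_extendPath hT φ).sub (continuous_extendPath hT Ψ))
  obtain ⟨D, hD⟩ := (isCompact_Icc (a := (0 : ℝ)) (b := T)).exists_bound_of_continuousOn
    hcont.continuousOn
  refine ⟨T * D ^ 2 / 4, fun N _ η hη => ?_⟩
  have hN : (0 : ℝ) < N := by exact_mod_cast Nat.pos_of_neZero N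
  have hη1 : 0 ≤ 1 + η⁻¹ := by positivity
  -- The competitor: all particles but the first follow the flow.
  let Φ : Fin N → Path d T := fun i => if i = 0 then φ else Ψ
  have hΦ0 : Φ 0 = φ := if_pos rfl
  have hΦ : ∀ i, i ≠ 0 → Φ i = Ψ := fun i hi => if_neg hi
  have hΦH : ∀ i, Φ i ∈ H hT x := fun i => by
    by_cases hi : i = 0
    · rw [hi, hΦ0]
      exact hφH
    · rw [hΦ i hi]
      exact hΨH
  refine (iInf₂_le Φ ⟨hΦ0, fun i _ => hΦH i⟩).trans ?_
  rw [I, if_pos hΦH, Finset.mul_sum, ← Finset.add_sum_erase _ _ (Finset.mem_univ 0)]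
  have hsmall : ∀ t ∈ Icc 0 T, ‖(1 / (N : ℝ)) • gradient F (f t - ψ t)‖ ^ 2 ≤ D ^ 2 / N ^ 2 := by
    intro t ht
    rw [norm_smul, mul_pow, Real.norm_of_nonneg (by positivity), one_div, inv_pow,
      inv_mul_eq_div]
    gcongr
    exact hD t ht
  have hfirst : 4⁻¹ * ∫⁻ t in Icc 0 T, ENNReal.ofReal
      (‖deriv (extendPath hT (Φ 0)) t + gradient V (extendPath hT (Φ 0) t) +
        (1 / (N : ℝ)) • ∑ k, gradient F (extendPath hT (Φ 0) t - extendPath hT (Φ k) t)‖ ^ 2) ≤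
      ENNReal.ofReal ((1 + η) * B + (1 + η⁻¹) * (T * (D ^ 2 / N ^ 2) / 4)) := by
    have hsum : ∀ t, deriv (extendPath hT (Φ 0)) t + gradient V (extendPath hT (Φ 0) t) +
        (1 / (N : ℝ)) • ∑ k, gradient F (extendPath hT (Φ 0) t - extendPath hT (Φ k) t) =
        (deriv f t + gradient V (f t) + gradient F (f t - ψ t)) +
          -((1 / (N : ℝ)) • gradient F (f t - ψ t)) := by
      intro t
      -- The self-interaction term vanishes, leaving N - 1 equal terms.
      have h1 : ∑ k, gradient F (extendPath hT (Φ 0) t - extendPath hT (Φ k) t) =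
          (N : ℝ) • gradient F (f t - ψ t) - gradient F (f t - ψ t) := by
        have h2 : ∀ k ∈ Finset.univ.erase (0 : Fin N),
            gradient F (extendPath hT (Φ 0) t - extendPath hT (Φ k) t) =
              gradient F (f t - ψ t) := fun k hk => by
          rw [hΦ0, hΦ k (Finset.ne_of_mem_erase hk)]
        rw [← Finset.add_sum_erase _ _ (Finset.mem_univ 0), Finset.sum_congr rfl h2, sub_self,
          hg.zero, zero_add, Finset.sum_const, Finset.card_erase_of_mem (Finset.mem_univ 0),
          Finset.card_univ, Fintype.card_fin, ← Nat.cast_smul_eq_nsmul ℝ,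
          Nat.cast_pred (Nat.pos_of_neZero N), sub_smul, one_smul]
      rw [h1, hΦ0, smul_sub, smul_smul, one_div_mul_cancel hN.ne', one_smul]
      abel
    simp only [hsum]
    exact lintegral_norm_add_sq_le_ofReal hT hη (by positivity) hB
      (fun t ht => by simpa only [norm_neg] using hsmall t ht) hφ
  have hother : ∀ i ∈ Finset.univ.erase (0 : Fin N), 4⁻¹ * ∫⁻ t in Icc 0 T, ENNReal.ofReal
      (‖deriv (extendPath hT (Φ i)) t + gradient V (extendPath hT (Φ i) t) +
        (1 / (N : ℝ)) • ∑ k, gradient F (extendPath hT (Φ i) t - extendPath hT (Φ k) t)‖ ^ 2) ≤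
      ENNReal.ofReal (T * (D ^ 2 / N ^ 2) / 4) := by
    intro i hi
    have hi0 := Finset.ne_of_mem_erase hi
    have hle : ∫⁻ t in Icc 0 T, ENNReal.ofReal
        (‖deriv (extendPath hT (Φ i)) t + gradient V (extendPath hT (Φ i) t) +
        (1 / (N : ℝ)) • ∑ k, gradient F (extendPath hT (Φ i) t - extendPath hT (Φ k) t)‖ ^ 2) ≤
        ENNReal.ofReal (D ^ 2 / N ^ 2 * T) := by
      rw [← restrict_Ioo_eq_restrict_Icc]
      refine (setLIntegral_mono' (g := fun _ => ENNReal.ofReal (D ^ 2 / N ^ 2))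
        measurableSet_Ioo fun t ht => ENNReal.ofReal_le_ofReal ?_).trans ?_
      · have h1 : ∑ k, gradient F (extendPath hT (Φ i) t - extendPath hT (Φ k) t) =
            -gradient F (f t - ψ t) := by
          rw [Finset.sum_eq_single 0 (fun k _ hk => by
            rw [hΦ i hi0, hΦ k hk, sub_self, hg.zero]) (by simp), hΦ i hi0, hΦ0, ← hg.neg, neg_sub]
        rw [h1, hΦ i hi0, (hΨ.hasDerivAt hV ht).deriv, neg_add_cancel, zero_add, smul_neg, norm_neg]
        exact hsmall t (Ioo_subset_Icc_self ht)
      · rw [setLIntegral_const, Real.volume_Ioo, sub_zero, ← ENNReal.ofReal_mul (by positivity)]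
    have h4 : (4⁻¹ : ℝ≥0∞) = ENNReal.ofReal 4⁻¹ := by
      rw [ENNReal.ofReal_inv_of_pos (by norm_num), ENNReal.ofReal_ofNat]
    calc _ ≤ 4⁻¹ * ENNReal.ofReal (D ^ 2 / N ^ 2 * T) := by gcongr
      _ = _ := by
        rw [h4, ← ENNReal.ofReal_mul (by positivity)]
        congr 1
        ring
  refine (add_le_add hfirst (Finset.sum_le_card_nsmul _ _ _ hother)).trans ?_
  rw [← ENNReal.ofReal_nsmul, ← ENNReal.ofReal_add (by positivity) (by positivity)]
  refine ENNReal.ofReal_le_ofReal ?_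
  rw [Finset.card_erase_of_mem (Finset.mem_univ 0), Finset.card_univ, Fintype.card_fin,
    nsmul_eq_mul, Nat.cast_pred (Nat.pos_of_neZero N)]
  have hN1 : (1 : ℝ) ≤ N := by exact_mod_cast Nat.pos_of_neZero N
  have hq : 0 ≤ T * (D ^ 2 / N ^ 2) / 4 := by positivity
  have h5 : T * D ^ 2 / 4 / N = N * (T * (D ^ 2 / N ^ 2) / 4) := by field_simp
  -- The first particle costs (1 + η⁻¹) q and each of the N - 1 others costs q, with q = T D² / (4
  -- N²); the total is at most (1 + η⁻¹) N q.
  have h6 : 0 ≤ η⁻¹ * ((N - 1) * (T * (D ^ 2 / N ^ 2) / 4)) :=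
    mul_nonneg (by positivity) (mul_nonneg (by linarith) hq)
  rw [h5]
  linarith

/-! ### Passage to the limit -/

/-- With N = n + 1, the choice η = 1/√N sends both η and η⁻¹/N to zero. -/
theorem tendsto_ofReal_error (B C : ℝ) :
    Tendsto (fun n : ℕ => ENNReal.ofReal ((1 + 1 / Real.sqrt (n + 1)) * B +
      (1 + (1 / Real.sqrt (n + 1))⁻¹) * (C / (n + 1 : ℕ)))) atTop (𝓝 (ENNReal.ofReal B)) := by
  refine ENNReal.tendsto_ofReal ?_
  have hn : Tendsto (fun n : ℕ => (n : ℝ) + 1) atTop atTop :=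
    tendsto_atTop_add_const_right _ _ tendsto_natCast_atTop_atTop
  have h1 : Tendsto (fun n : ℕ => 1 / Real.sqrt ((n : ℝ) + 1)) atTop (𝓝 0) := by
    simp only [one_div]
    exact tendsto_inv_atTop_zero.comp (Real.tendsto_sqrt_atTop.comp hn)
  have h2 : Tendsto (fun n : ℕ => ((n : ℝ) + 1)⁻¹) atTop (𝓝 0) := tendsto_inv_atTop_zero.comp hn
  have h3 : Tendsto (fun n : ℕ => (1 + 1 / Real.sqrt (n + 1)) * B +
      C * (((n : ℝ) + 1)⁻¹ + 1 / Real.sqrt (n + 1))) atTop (𝓝 ((1 + 0) * B + C * (0 + 0))) :=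
    ((h1.const_add 1).mul_const B).add ((h2.add h1).const_mul C)
  simp only [add_zero, one_mul, mul_zero] at h3
  refine h3.congr fun n => ?_
  have hs : 0 < Real.sqrt ((n : ℝ) + 1) := Real.sqrt_pos.2 (by positivity)
  have hsq : Real.sqrt ((n : ℝ) + 1) ^ 2 = (n : ℝ) + 1 := Real.sq_sqrt (by positivity)
  push_cast
  rw [← hsq]
  rw [Real.sqrt_sq hs.le]
  field_simp

theorem tendsto_iInf_J (hT : 0 ≤ T) {V F : State d → ℝ} {x : State d} {K c : ℝ}
    (hK : 0 ≤ K) (hc : 0 ≤ c) (hV : Continuous (gradient V))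
    (hone : ∀ y z : State d, -K * ‖y - z‖ ^ 2 ≤ inner ℝ (gradient V y - gradient V z) (y - z))
    (hg : IsInteractionForce (gradient F) c) {Ψ : Path d T} (hΨ : IsLimitFlow hT V x Ψ)
    (O : Set (Path d T)) :
    Tendsto (fun n : ℕ => ⨅ φ ∈ O, J hT V F x (n + 1) φ) atTop
      (𝓝 (⨅ φ ∈ O, Jinf hT V F x Ψ φ)) := by
  have hη : ∀ n : ℕ, 0 < 1 / Real.sqrt ((n : ℝ) + 1) := fun n =>
    one_div_pos.2 (Real.sqrt_pos.2 (by positivity))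
  refine tendsto_order.2 ⟨fun a ha => ?_, fun a ha => ?_⟩
  -- A finite level B is inserted below the limit infimum, which may be infinite. C is fixed before
  -- φ and Φ are chosen.
  · obtain ⟨B, hB, haB, hBA⟩ := ENNReal.lt_iff_exists_real_btwn.1 ha
    obtain ⟨C, hC⟩ := exists_Jinf_le hT hK hc hV hone hg hΨ hB
    filter_upwards [(tendsto_ofReal_error B C).eventually_lt_const hBA] with n hn
    by_contra! hcon
    obtain ⟨φ, hφ⟩ := iInf_lt_iff.1 (hcon.trans_lt haB)
    obtain ⟨hφO, hφ⟩ := iInf_lt_iff.1 hφ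
    obtain ⟨Φ, hφ⟩ := iInf_lt_iff.1 hφ
    obtain ⟨⟨hΦ, -⟩, hI⟩ := iInf_lt_iff.1 hφ
    have hJ := hC (n + 1) Φ _ (hη n) hI.le
    rw [hΦ] at hJ
    exact absurd ((iInf₂_le φ hφO).trans hJ) (not_le.2 hn)
  -- One near-minimizer φ suffices here, so C may depend on it.
  · obtain ⟨φ, hφ⟩ := iInf_lt_iff.1 ha
    obtain ⟨hφO, hφ⟩ := iInf_lt_iff.1 hφ
    obtain ⟨B, hB, hφB, hBa⟩ := ENNReal.lt_iff_exists_real_btwn.1 hφ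
    obtain ⟨C, hC⟩ := exists_J_le hT hV hg hΨ hB hφB.le
    filter_upwards [(tendsto_ofReal_error B C).eventually_lt_const hBa] with n hn
    exact (iInf₂_le φ hφO).trans_lt ((hC (n + 1) _ (hη n)).trans_lt hn)

end MeanField

theorem corollary3p1 {d : ℕ} {T : ℝ} (hT : 0 < T) (x : MeanField.State d)
    (V F : MeanField.State d → ℝ)
    (hV : MeanField.IsConfiningPotential V) (hF : MeanField.IsInteractionPotential F) :
    (∃! Ψ : MeanField.Path d T, MeanField.IsLimitFlow hT.le V x Ψ) ∧
    ∀ Ψ : MeanField.Path d T, MeanField.IsLimitFlow hT.le V x Ψ →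
      ∀ O : Set (MeanField.Path d T), IsOpen O ∨ IsClosed O →
        Tendsto (fun n : ℕ => ⨅ φ ∈ O, MeanField.J hT.le V F x (n + 1) φ) atTop
          (𝓝 (⨅ φ ∈ O, MeanField.Jinf hT.le V F x Ψ φ)) := by
  obtain ⟨K, hK, hone⟩ := hV.exists_oneSided
  obtain ⟨c, hc, hg⟩ := hF.isInteractionForce
  have hV1 := MeanField.contDiff_gradient hV.1
  obtain ⟨Ψ, hΨ⟩ := MeanField.exists_isLimitFlow hT.le hV1 hK hone x
  exact ⟨⟨Ψ, hΨ, fun Ψ' hΨ' => hΨ'.unique hT.le hK hc hV1.continuous hone hg hΨ⟩,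
    fun Ψ' hΨ' O _ => MeanField.tendsto_iInf_J hT.le hK hc hV1.continuous hone hg hΨ' O⟩
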